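/- Call a nonempty connected compact Hausdorff space a continuum. For a compact Hausdorff space $X$ let $C(X)$ be the unital C*-algebra of continuous functions $X\to\mathbb C$. For an ultrafilter $\mathcal U$ on a set $I$, let $A^{\mathcal U}$ be the C*-algebra ultrapower of $A$ (bounded families $(a_i)_{i\in I}$ in $A$, modulo those with $\lim_{\mathcal U}\|a_i\|=0$), and let $X_{\mathcal U}$ be the ultracopower of $X$, that is, the inverse limit over $J\in\mathcal U$ (ordered by inclusion) of the Stone–Čech compactifications $\beta\big(\bigoplus_{i\in J}X\big)$. Theorem (K.P. Hart). (1) Let $X$ and $Y$ be continua such that $X$ is not a point. Then there are a set $I$ and an ultrafilter $\mathcal U$ on $I$ such that $C(Y)$ embeds in $C(X)^{\mathcal U}$ (by an injective unital $*$-homomorphism) and there is a continuous surjection $X_{\mathcal U}\to Y$. Moreover, for every set $I$ and every ultrafilter $\mathcal U$ on $I$, $C(Y)$ embeds in $C(X)^{\mathcal U}$ if and only if there is a continuous surjection $X_{\mathcal U}\to Y$. (2) Consequently, all nondegenerate projectionless unital abelian C*-algebras have the same universal theory: if $A$ and $B$ are nonzero unital abelian C*-algebras whose only projections are $0$ and $1$,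 and neither is isomorphic to $\mathbb C$, then $\sigma^A=\sigma^B$ for every universal sentence $\sigma=\sup_{\|x_1\|\le r_1}\cdots\sup_{\|x_n\|\le r_n}\varphi(x_1,\dots,x_n)$ of continuous logic, with $r_1,\dots,r_n\in\mathbb N$ and $\varphi$ quantifier-free in the language of unital C*-algebras (a formula built from norms of terms by continuous real-valued connectives). -/

import Mathlib

open Filter Topology
open scoped ENNReal

universe u v w

noncomputable section

/-! ### Ultrapowers of commutative C*-algebras -/

/-- The ideal, in the C*-algebra `lp (fun _ : I => A) ∞` of bounded families in `A`, of those
families whose norms converge to `0` along the ultrafilter `U`. -/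
def nullIdeal {I : Type w} (U : Ultrafilter I) (A : Type u) [CommCStarAlgebra A] [Nontrivial A] :
    Ideal (lp (fun _ : I => A) ∞) where
  carrier := {f | Tendsto (fun i => ‖f i‖) U (𝓝 0)}
  zero_mem' := by simp
  add_mem' := by
    intro f g hf hg
    have h := Tendsto.add hf hg
    rw [add_zero] at h
    exact squeeze_zero (fun i => norm_nonneg _) (fun i => norm_add_le (f i) (g i)) h
  smul_mem' := by
    intro c f hf
    have h := Tendsto.const_mul ‖c‖ hf
    rw [mul_zero] at h
    refine squeeze_zero (fun i => norm_nonneg _) (fun i => ?_) h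
    calc ‖c i * f i‖ ≤ ‖c i‖ * ‖f i‖ := norm_mul_le _ _
      _ ≤ ‖c‖ * ‖f i‖ := by
        gcongr
        exact lp.norm_apply_le_norm (by simp) c i

/-- The C*-algebra ultrapower `A^U`: bounded families in `A`, modulo those that
converge to `0` along `U`. Its norm is the quotient norm. -/
def Ultrapower {I : Type w} (U : Ultrafilter I) (A : Type u) [CommCStarAlgebra A]
    [Nontrivial A] : Type (max u w) :=
  lp (fun _ : I => A) ∞ ⧸ nullIdeal U A

namespace Ultrapower

variable {I : Type w} (U : Ultrafilter I) (A : Type u) [CommCStarAlgebra A] [Nontrivial A]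

theorem mem_nullIdeal (f : lp (fun _ : I => A) ∞) :
    f ∈ nullIdeal U A ↔ Tendsto (fun i => ‖f i‖) U (𝓝 0) := Iff.rfl

/-- A bounded family of norms converges along an ultrafilter. -/
theorem exists_tendsto_norm (f : lp (fun _ : I => A) ∞) :
    ∃ L : ℝ, Tendsto (fun i => ‖f i‖) U (𝓝 L) := by
  have hK : IsCompact (Set.Icc (0 : ℝ) ‖f‖) := isCompact_Icc
  obtain ⟨L, -, hL⟩ := hK.ultrafilter_le_nhds (U.map (fun i => ‖f i‖)) (by
    rw [le_principal_iff]
    exact Ultrafilter.mem_map.2 (Filter.univ_mem' (fun i =>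
      ⟨norm_nonneg _, lp.norm_apply_le_norm (by simp) f i⟩)))
  exact ⟨L, hL⟩

instance isClosed_nullIdeal : IsClosed (nullIdeal U A : Set (lp (fun _ : I => A) ∞)) := by
  rw [← isSeqClosed_iff_isClosed]
  intro x f hx hf
  show Tendsto (fun i => ‖f i‖) U (𝓝 0)
  rw [Metric.tendsto_nhds]
  intro ε hε
  obtain ⟨n, hn⟩ := ((Metric.tendsto_nhds.1 hf) (ε / 2) (half_pos hε)).exists
  have h0 : Tendsto (fun i => ‖x n i‖) U (𝓝 0) := hx n
  filter_upwards [(Metric.tendsto_nhds.1 h0) (ε / 2) (half_pos hε)] with i hi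
  have h1 : ‖(x n - f) i‖ ≤ ‖x n - f‖ := lp.norm_apply_le_norm (by simp) _ i
  have h2 : ‖f i‖ ≤ ‖x n i‖ + ‖(x n - f) i‖ := by
    have : f i = x n i - (x n - f) i := by simp
    rw [this]
    exact norm_sub_le _ _
  rw [dist_eq_norm] at hn
  simp only [dist_zero_right, norm_norm] at hi ⊢
  linarith

instance : NormedCommRing (Ultrapower U A) :=
  inferInstanceAs (NormedCommRing (lp (fun _ : I => A) ∞ ⧸ nullIdeal U A))

instance : NormedAlgebra ℂ (Ultrapower U A) :=
  inferInstanceAs (NormedAlgebra ℂ (lp (fun _ : I => A) ∞ ⧸ nullIdeal U A))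

instance : CompleteSpace (Ultrapower U A) :=
  inferInstanceAs (CompleteSpace (lp (fun _ : I => A) ∞ ⧸ nullIdeal U A))

/-- The class in the ultrapower of a bounded family. -/
def mk : lp (fun _ : I => A) ∞ →ₐ[ℂ] Ultrapower U A :=
  Ideal.Quotient.mkₐ ℂ (nullIdeal U A)

theorem mk_surjective : Function.Surjective (mk U A) :=
  Ideal.Quotient.mk_surjective

theorem mk_eq_mk_iff (f g : lp (fun _ : I => A) ∞) :
    mk U A f = mk U A g ↔ Tendsto (fun i => ‖f i - g i‖) U (𝓝 0) :=
  Ideal.Quotient.mk_eq_mk_iff_sub_mem f g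

/-- The norm of the class of `(f i)` is the limit of `‖f i‖` along `U`. -/
theorem norm_mk_eq (f : lp (fun _ : I => A) ∞) {L : ℝ}
    (hL : Tendsto (fun i => ‖f i‖) U (𝓝 L)) : ‖mk U A f‖ = L := by
  classical
  apply le_antisymm
  · refine le_of_forall_pos_le_add (fun ε hε => ?_)
    have hL0 : 0 ≤ L := ge_of_tendsto' hL (fun i => norm_nonneg _)
    let g0 : I → A := fun i => if ‖f i‖ ≤ L + ε then f i else 0
    have hg0 : ∀ i, ‖g0 i‖ ≤ L + ε := by
      intro i
      by_cases h : ‖f i‖ ≤ L + ε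
      · simp [g0, h]
      · simp only [g0, h, if_false, norm_zero]
        linarith
    let g : lp (fun _ : I => A) ∞ :=
      ⟨g0, memℓp_infty ⟨L + ε, by rintro _ ⟨i, rfl⟩; exact hg0 i⟩⟩
    have hfg : mk U A f = mk U A g := by
      rw [mk_eq_mk_iff]
      refine Tendsto.congr' ?_ tendsto_const_nhds
      filter_upwards [hL.eventually (eventually_le_nhds (by linarith : L < L + ε))] with i hi
      have : g i = f i := by
        show g0 i = f i
        simp [g0, hi]
      simp [this]
    rw [hfg]
    exact (Ideal.Quotient.norm_mk_le (nullIdeal U A) g).trans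
      (lp.norm_le_of_forall_le (by linarith) hg0)
  · refine le_of_forall_pos_le_add (fun ε hε => ?_)
    obtain ⟨g, hg, hgn⟩ := Ideal.Quotient.norm_mk_lt (I := nullIdeal U A) (mk U A f) hε
    have hfg : Tendsto (fun i => ‖f i - g i‖) U (𝓝 0) := (mk_eq_mk_iff U A f g).1 hg.symm
    have h1 : Tendsto (fun i => ‖f i - g i‖ + ‖g‖) U (𝓝 (0 + ‖g‖)) := hfg.add_const _
    have h2 : L ≤ 0 + ‖g‖ := le_of_tendsto_of_tendsto' hL h1 (fun i => by
      have h3 : ‖g i‖ ≤ ‖g‖ := lp.norm_apply_le_norm (by simp) g i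
      have h4 : ‖f i‖ ≤ ‖f i - g i‖ + ‖g i‖ := by
        simpa using norm_add_le (f i - g i) (g i)
      linarith)
    have h5 : ‖g‖ < ‖mk U A f‖ + ε := hgn
    linarith

instance : Star (Ultrapower U A) where
  star := Quotient.map' star (by
    intro f g h
    have h' : f - g ∈ nullIdeal U A := (Submodule.quotientRel_def _).1 h
    refine (Submodule.quotientRel_def _).2 ?_
    rw [mem_nullIdeal] at h' ⊢
    refine h'.congr (fun i => ?_)
    rw [← star_sub]
    exact (norm_star ((f - g) i)).symm)

theorem star_mk (f : lp (fun _ : I => A) ∞) : star (mk U A f) = mk U A (star f) := rfl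

instance : StarRing (Ultrapower U A) where
  star_involutive := by
    intro x
    obtain ⟨f, rfl⟩ := mk_surjective U A x
    rw [star_mk, star_mk, star_star]
  star_mul := by
    intro x y
    obtain ⟨f, rfl⟩ := mk_surjective U A x
    obtain ⟨g, rfl⟩ := mk_surjective U A y
    rw [star_mk, star_mk, ← map_mul, ← map_mul, star_mk, star_mul]
  star_add := by
    intro x y
    obtain ⟨f, rfl⟩ := mk_surjective U A x
    obtain ⟨g, rfl⟩ := mk_surjective U A y
    rw [star_mk, star_mk, ← map_add, ← map_add, star_mk, star_add]

instance : StarModule ℂ (Ultrapower U A) where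
  star_smul := by
    intro c x
    obtain ⟨f, rfl⟩ := mk_surjective U A x
    rw [star_mk, ← map_smul, ← map_smul, star_mk, star_smul]

instance : CStarRing (Ultrapower U A) where
  norm_mul_self_le := by
    intro x
    obtain ⟨f, rfl⟩ := mk_surjective U A x
    obtain ⟨L, hL⟩ := exists_tendsto_norm U A f
    rw [star_mk, ← map_mul, norm_mk_eq U A f hL, norm_mk_eq U A (star f * f) (L := L * L)]
    refine (hL.mul hL).congr (fun i => ?_)
    exact (CStarRing.norm_star_mul_self (x := f i)).symm

instance : CommCStarAlgebra (Ultrapower U A) where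

end Ultrapower

/-- `A` embeds in `B`: there is an injective unital `*`-homomorphism from `A` to `B`. -/
def CStarEmbeds (A : Type u) (B : Type v) [CStarAlgebra A] [CStarAlgebra B] : Prop :=
  ∃ φ : A →⋆ₐ[ℂ] B, Function.Injective φ

/-! ### Ultracopowers of compact Hausdorff spaces -/

/-- The inclusion `⨁_{i ∈ J} X ⊆ ⨁_{i ∈ K} X` of topological sums, for `J ⊆ K`. -/
def sumInclusion {I : Type w} (X : Type u) {J K : Set I} (h : J ⊆ K) :
    (Σ _ : J, X) → (Σ _ : K, X) :=
  fun p => ⟨Set.inclusion h p.1, p.2⟩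

theorem continuous_sumInclusion {I : Type w} (X : Type u) [TopologicalSpace X] {J K : Set I}
    (h : J ⊆ K) : Continuous (sumInclusion X h) :=
  continuous_sigma (fun j => continuous_sigmaMk (σ := fun _ : K => X) (i := Set.inclusion h j))

/-- The bonding map `β(⨁_{i ∈ J} X) → β(⨁_{i ∈ K} X)` for `J ⊆ K`. -/
def coproductMap {I : Type w} (X : Type u) [TopologicalSpace X] {J K : Set I} (h : J ⊆ K) :
    StoneCech (Σ _ : J, X) → StoneCech (Σ _ : K, X) :=
  stoneCechExtend (continuous_stoneCechUnit.comp (continuous_sumInclusion X h))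

/-- The ultracopower `X_U`: the inverse limit, over `J ∈ U`, of the Stone-Cech compactifications
of the topological sums `⨁_{i ∈ J} X`. -/
def Ultracopower {I : Type w} (U : Ultrafilter I) (X : Type u) [TopologicalSpace X] :
    Type (max u w) :=
  {p : (J : {J : Set I // J ∈ U}) → StoneCech (Σ _ : J.1, X) //
    ∀ (J K : {J : Set I // J ∈ U}) (h : J.1 ⊆ K.1), coproductMap X h (p J) = p K}

instance {I : Type w} (U : Ultrafilter I) (X : Type u) [TopologicalSpace X] :
    TopologicalSpace (Ultracopower U X) :=
  instTopologicalSpaceSubtype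

/-! ### Universal sentences in the language of unital C*-algebras -/

/-- Terms in `n` variables in the language of unital C*-algebras. -/
inductive CStarTerm (n : ℕ) : Type
  | var (k : Fin n) : CStarTerm n
  | zero : CStarTerm n
  | one : CStarTerm n
  | add (s t : CStarTerm n) : CStarTerm n
  | mul (s t : CStarTerm n) : CStarTerm n
  | smul (c : ℂ) (t : CStarTerm n) : CStarTerm n
  | star (t : CStarTerm n) : CStarTerm n

/-- The interpretation of a term in a C*-algebra. -/
def CStarTerm.eval {n : ℕ} {A : Type u} [CStarAlgebra A] (a : Fin n → A) : CStarTerm n → A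
  | .var k => a k
  | .zero => 0
  | .one => 1
  | .add s t => s.eval a + t.eval a
  | .mul s t => s.eval a * t.eval a
  | .smul c t => c • t.eval a
  | .star t => Star.star (t.eval a)

/-- Quantifier-free formulas of continuous logic, in `n` variables, in the language of unital
C*-algebras: the atomic formulas are norms of terms, and every continuous function
`ℝ^k → ℝ` is a connective. -/
inductive QFFormula (n : ℕ) : Type
  | norm (t : CStarTerm n) : QFFormula n
  | conn {k : ℕ} (c : C(Fin k → ℝ, ℝ)) (φ : Fin k → QFFormula n) : QFFormula n

/-- The value of a quantifier-free formula at a tuple of a C*-algebra. -/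
def QFFormula.eval {n : ℕ} {A : Type u} [CStarAlgebra A] (a : Fin n → A) : QFFormula n → ℝ
  | .norm t => ‖t.eval a‖
  | .conn c φ => c (fun j => (φ j).eval a)

/-- Universal sentences `sup_{‖x₁‖ ≤ r₁} ⋯ sup_{‖xₙ‖ ≤ rₙ} φ(x₁, …, xₙ)`, where `φ` is
quantifier-free. -/
structure UniversalSentence : Type where
  numVars : ℕ
  radius : Fin numVars → ℕ
  formula : QFFormula numVars

/-- The value of a universal sentence in a C*-algebra. -/
def UniversalSentence.value (σ : UniversalSentence) (A : Type u) [CStarAlgebra A] : ℝ :=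
  sSup {r : ℝ | ∃ a : Fin σ.numVars → A, (∀ k, ‖a k‖ ≤ σ.radius k) ∧ σ.formula.eval a = r}

theorem CStarTerm.exists_bound {n : ℕ} (R : Fin n → ℕ) (A : Type u) [CStarAlgebra A]
    (t : CStarTerm n) :
    ∃ C : ℝ, ∀ a : Fin n → A, (∀ k, ‖a k‖ ≤ R k) → ‖t.eval a‖ ≤ C := by
  induction t with
  | var k => exact ⟨R k, fun a ha => ha k⟩
  | zero => exact ⟨‖(0 : A)‖, fun a _ => le_rfl⟩
  | one => exact ⟨‖(1 : A)‖, fun a _ => le_rfl⟩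
  | add s t hs ht =>
    obtain ⟨C, hC⟩ := hs
    obtain ⟨D, hD⟩ := ht
    exact ⟨C + D, fun a ha => (norm_add_le _ _).trans (add_le_add (hC a ha) (hD a ha))⟩
  | mul s t hs ht =>
    obtain ⟨C, hC⟩ := hs
    obtain ⟨D, hD⟩ := ht
    exact ⟨C * D, fun a ha => (norm_mul_le _ _).trans
      (mul_le_mul (hC a ha) (hD a ha) (norm_nonneg _) ((norm_nonneg _).trans (hC a ha)))⟩
  | smul c t ht =>
    obtain ⟨C, hC⟩ := ht
    exact ⟨‖c‖ * C, fun a ha => (norm_smul_le _ _).trans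
      (mul_le_mul_of_nonneg_left (hC a ha) (norm_nonneg _))⟩
  | star t ht =>
    obtain ⟨C, hC⟩ := ht
    exact ⟨C, fun a ha => (norm_star _).trans_le (hC a ha)⟩

theorem QFFormula.exists_bound {n : ℕ} (R : Fin n → ℕ) (A : Type u) [CStarAlgebra A]
    (φ : QFFormula n) :
    ∃ C : ℝ, ∀ a : Fin n → A, (∀ k, ‖a k‖ ≤ R k) → |φ.eval a| ≤ C := by
  induction φ with
  | norm t =>
    obtain ⟨C, hC⟩ := t.exists_bound R A
    exact ⟨C, fun a ha => (abs_norm _).trans_le (hC a ha)⟩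
  | @conn k c φ ih =>
    choose C hC using ih
    have hK : IsCompact (Set.pi Set.univ (fun j : Fin k => Set.Icc (-C j) (C j))) :=
      isCompact_univ_pi (fun j => isCompact_Icc)
    obtain ⟨D, hD⟩ := hK.exists_bound_of_continuousOn c.continuous.continuousOn
    exact ⟨D, fun a ha => hD _ (fun j _ => abs_le.1 (hC j a ha))⟩

/-- The supremum in the value of a universal sentence is over a non-empty bounded set. -/
theorem UniversalSentence.isLUB_value (σ : UniversalSentence) (A : Type u) [CStarAlgebra A] :
    IsLUB {r : ℝ | ∃ a : Fin σ.numVars → A, (∀ k, ‖a k‖ ≤ σ.radius k) ∧ σ.formula.eval a = r}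
      (σ.value A) := by
  refine isLUB_csSup ⟨_, 0, fun k => by simp, rfl⟩ ?_
  obtain ⟨C, hC⟩ := σ.formula.exists_bound σ.radius A
  refine ⟨C, ?_⟩
  rintro _ ⟨a, ha, rfl⟩
  exact (le_abs_self _).trans (hC a ha)

/-- The universal theory of a C*-algebra: the assignment to each universal sentence of its value. -/
def universalTheory (A : Type u) [CStarAlgebra A] : UniversalSentence → ℝ :=
  fun σ => σ.value A

/-! ### Projectionless algebras -/

/-- A nonzero unital C*-algebra is projectionless if `0` and `1` are its only projections. -/
def IsProjectionless (A : Type u) [CStarAlgebra A] : Prop :=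
  Nontrivial A ∧ ∀ p : A, IsStarProjection p → p = 0 ∨ p = 1

/-- A unital C*-algebra is degenerate if it is `*`-isomorphic to `ℂ`, the algebra of continuous
functions on a point. -/
def IsDegenerate (A : Type u) [CStarAlgebra A] : Prop :=
  Nonempty (A ≃⋆ₐ[ℂ] ℂ)

end

/-!
A finite set of functions `f₁, …, fₙ` on a continuum `Y` maps `Y` onto a compact connected subset
`K` of `ℂⁿ`. The open `ε`-neighbourhood of `K` is open and connected, hence path connected, so it
contains a path through a finite `ε`-net of `K`. A nondegenerate continuum `X` maps onto the unit
interval by Urysohn's lemma; composing with the path gives functions `g₁, …, gₙ` on `X` whose joint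
range is within Hausdorff distance `ε` of `K` (`exists_approx`). Thus the `g`'s satisfy the algebraic
relations among the `f`'s up to a multiple of `ε` and have nearly the same norms, and an ultrafilter
on the pairs (finite set of functions, tolerance) turns these approximations into an injective
`*`-homomorphism from `C(Y)` to an ultrapower of `C(X)` (`exists_cstarEmbeds_ultrapower`).

For any ultrafilter `U`, the ultrapower `C(X)^U` is the algebra of continuous functions on the
ultracopower `X_U` (`Ultracopower.starAlgEquiv`). The space `X_U` embeds in `β(⨁ X)`, and a bounded
family of functions on `X` is a bounded function on `⨁ X`, which extends to `β(⨁ X)` and restricts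
to `X_U`. Every function on `X_U` arises in this way by Tietze's theorem, and the families that
restrict to `0` are the null ones because every family of points `x i` of `X` has a limit in `X_U`.
Gelfand duality then translates embeddings of `C(Y)` into surjections onto `Y`.

A nondegenerate projectionless abelian algebra is `C(X)` for a nondegenerate continuum `X`, so any
two such algebras embed in ultrapowers of each other. Embeddings are isometric and preserve
quantifier-free formulas, and quantifier-free formulas in an ultrapower are limits of their values
in the factors (`QFFormula.tendsto_eval`), so the values of universal sentences agree.
-/

noncomputable section

/-! ### Approximating a continuum by images of another one -/

/-- A nondegenerate continuum maps continuously onto the unit interval. -/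
theorem exists_surjective_unitInterval (X : Type u) [TopologicalSpace X] [CompactSpace X]
    [T2Space X] [ConnectedSpace X] [Nontrivial X] :
    ∃ h : C(X, unitInterval), Function.Surjective h := by
  obtain ⟨a, b, hab⟩ := exists_pair_ne X
  obtain ⟨f, hfa, hfb, hf⟩ := exists_continuous_zero_one_of_isClosed
    (isClosed_singleton : IsClosed {a}) (isClosed_singleton : IsClosed {b})
    (Set.disjoint_singleton.2 hab)
  have hsub : Set.Icc (0 : ℝ) 1 ⊆ Set.range f := by
    have h := (isPreconnected_range f.continuous).Icc_subset (Set.mem_range_self a)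
      (Set.mem_range_self b)
    rwa [hfa rfl, hfb rfl] at h
  refine ⟨⟨fun x => ⟨f x, hf x⟩, by fun_prop⟩, fun t => ?_⟩
  obtain ⟨x, hx⟩ := hsub t.2
  exact ⟨x, Subtype.ext hx⟩

/-- The open `ε`-neighbourhood of a compact connected set contains a path
that passes within `ε` of every point of the set. -/
theorem exists_path_thickening {E : Type*} [NormedAddCommGroup E] [NormedSpace ℝ E] {K : Set E}
    (hK : IsCompact K) (hc : IsConnected K) {ε : ℝ} (hε : 0 < ε) :
    ∃ γ : C(unitInterval, E), (∀ t, ∃ k ∈ K, dist (γ t) k < ε) ∧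
      ∀ k ∈ K, ∃ t, dist (γ t) k < ε := by
  obtain ⟨k₀, hk₀⟩ := hc.nonempty
  have hsub : K ⊆ Metric.thickening ε K := Metric.self_subset_thickening hε K
  have hconn : IsConnected (Metric.thickening ε K) := by
    refine ⟨⟨k₀, hsub hk₀⟩, isPreconnected_of_forall k₀ fun y hy => ?_⟩
    obtain ⟨k, hk, hyk⟩ := Metric.mem_thickening_iff.1 hy
    refine ⟨K ∪ Metric.ball k ε, Set.union_subset hsub (Metric.ball_subset_thickening hk ε),
      Or.inl hk₀, Or.inr hyk, ?_⟩
    exact hc.isPreconnected.union k hk (Metric.mem_ball_self hε)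
      (convex_ball k ε).isPreconnected
  have hpath := Metric.isOpen_thickening.isConnected_iff_isPathConnected.1 hconn
  obtain ⟨t, htK, htf, ht⟩ := hK.finite_cover_balls hε
  -- `k₀` is added to the net so that it is nonempty, as an enumeration by `Fin (n + 1)` demands.
  have htf' : (insert k₀ t).Finite := htf.insert k₀
  obtain ⟨n, p, hp⟩ : ∃ (n : ℕ) (p : Fin (n + 1) → E), Set.range p = insert k₀ t := by
    obtain ⟨m, p, hp⟩ := htf'.fin_param
    cases m with
    | zero =>
      have : k₀ ∈ Set.range p := hp.2 ▸ Set.mem_insert _ _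
      obtain ⟨i, -⟩ := this
      exact i.elim0
    | succ n => exact ⟨n, p, hp.2⟩
  have hpK : ∀ i, p i ∈ K := fun i => by
    have : p i ∈ insert k₀ t := hp ▸ Set.mem_range_self i
    rcases this with h | h
    · exact h ▸ hk₀
    · exact htK h
  obtain ⟨γ, hγ, hγp⟩ := hpath.exists_path_through_family p (fun i => hsub (hpK i))
  refine ⟨γ.toContinuousMap, fun s => ?_, fun k hk => ?_⟩
  · exact Metric.mem_thickening_iff.1 (hγ (Set.mem_range_self s))
  · obtain ⟨q, hq, hkq⟩ := Set.mem_iUnion₂.1 (ht hk)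
    have : q ∈ Set.range p := hp ▸ Set.mem_insert_of_mem _ hq
    obtain ⟨i, rfl⟩ := this
    obtain ⟨s, hs⟩ := hγp i
    refine ⟨s, ?_⟩
    have : dist k (p i) < ε := hkq
    rw [← hs, dist_comm] at this
    exact this

/-- Finitely many functions on a continuum `Y` have approximate copies on any nondegenerate
continuum `X`: the joint ranges are within Hausdorff distance `ε` of each other. -/
theorem exists_approx (X : Type u) (Y : Type v)
    [TopologicalSpace X] [CompactSpace X] [T2Space X] [ConnectedSpace X] [Nontrivial X]
    [TopologicalSpace Y] [CompactSpace Y] [ConnectedSpace Y]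
    (S : Finset C(Y, ℂ)) {ε : ℝ} (hε : 0 < ε) :
    ∃ Φ : C(Y, ℂ) → C(X, ℂ), (∀ f ∉ S, Φ f = 0) ∧
      (∀ x, ∃ y, ∀ f ∈ S, ‖Φ f x - f y‖ ≤ ε) ∧ ∀ y, ∃ x, ∀ f ∈ S, ‖Φ f x - f y‖ ≤ ε := by
  classical
  let F : Y → (S → ℂ) := fun y f => f.1 y
  have hF : Continuous F := continuous_pi fun f => f.1.continuous
  obtain ⟨γ, h1, h2⟩ := exists_path_thickening (isCompact_range hF) (isConnected_range hF) hε
  obtain ⟨h, hh⟩ := exists_surjective_unitInterval X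
  let Φ : C(Y, ℂ) → C(X, ℂ) := fun f =>
    if hf : f ∈ S then ⟨fun x => γ (h x) ⟨f, hf⟩, by fun_prop⟩ else 0
  have key : ∀ x y, dist (γ (h x)) (F y) < ε → ∀ f ∈ S, ‖Φ f x - f y‖ ≤ ε := by
    intro x y hxy f hf
    have h3 := (dist_le_pi_dist (γ (h x)) (F y) ⟨f, hf⟩).trans hxy.le
    simpa [Φ, hf, F, dist_eq_norm] using h3
  refine ⟨Φ, fun f hf => by simp [Φ, hf], fun x => ?_, fun y => ?_⟩
  · obtain ⟨_, ⟨y, rfl⟩, hy⟩ := h1 (h x)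
    exact ⟨y, key x y hy⟩
  · obtain ⟨t, ht⟩ := h2 (F y) ⟨y, rfl⟩
    obtain ⟨x, rfl⟩ := hh t
    exact ⟨x, key x y ht⟩

/-- The algebra of a continuum embeds in an ultrapower of the algebra of any nondegenerate
continuum. The index set consists of the finite sets of functions and the tolerances. -/
theorem exists_cstarEmbeds_ultrapower (X : Type u) (Y : Type v)
    [TopologicalSpace X] [CompactSpace X] [T2Space X] [ConnectedSpace X] [Nontrivial X]
    [TopologicalSpace Y] [CompactSpace Y] [ConnectedSpace Y] :
    ∃ (I : Type v) (U : Ultrafilter I), CStarEmbeds C(Y, ℂ) (Ultrapower U C(X, ℂ)) := by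
  classical
  let I : Type v := Finset C(Y, ℂ) × ℕ
  let e : I → ℝ := fun i => 1 / ((i.2 : ℝ) + 1)
  have he : ∀ i, 0 < e i := fun i => Nat.one_div_pos_of_nat
  have he1 : ∀ i, e i ≤ 1 := fun i => by
    have : (0 : ℝ) ≤ i.2 := Nat.cast_nonneg _
    exact (div_le_one (by linarith)).2 (by linarith)
  let U : Ultrafilter I := Ultrafilter.of atTop
  have hU : (U : Filter I) ≤ atTop := Ultrafilter.of_le _
  have he0 : Tendsto e U (𝓝 0) := by
    have h : Tendsto (fun i : I => i.2) atTop atTop := by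
      rw [← prod_atTop_atTop_eq]
      exact tendsto_snd
    exact (tendsto_one_div_add_atTop_nhds_zero_nat.comp h).mono_left hU
  have hmem : ∀ f : C(Y, ℂ), ∀ᶠ i : I in U, f ∈ i.1 := fun f => by
    refine hU ((eventually_ge_atTop (({f}, 0) : I)).mono fun i hi => ?_)
    exact hi.1 (Finset.mem_singleton_self f)
  choose Φ hΦ0 hΦ1 hΦ2 using fun i : I => exists_approx X Y i.1 (he i)
  -- `f ↦ f ∘ s i` is a `*`-homomorphism into functions on `X` (not continuous ones, as `s i` is
  -- merely chosen), and `Φ i f` is eventually within `e i` of it.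
  choose s hs using hΦ1
  have hbound : ∀ f i, ‖Φ i f‖ ≤ ‖f‖ + 1 := by
    intro f i
    by_cases hf : f ∈ i.1
    · refine (ContinuousMap.norm_le_of_nonempty _).2 fun x => ?_
      have h1 := hs i x f hf
      have h2 := norm_add_le (Φ i f x - f (s i x)) (f (s i x))
      rw [sub_add_cancel] at h2
      linarith [f.norm_coe_le_norm (s i x), he1 i]
    · rw [hΦ0 i f hf, norm_zero]
      positivity
  let F : C(Y, ℂ) → lp (fun _ : I => C(X, ℂ)) ∞ := fun f =>
    ⟨fun i => Φ i f, memℓp_infty ⟨‖f‖ + 1, by rintro _ ⟨i, rfl⟩; exact hbound f i⟩⟩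
  have hFs : ∀ f, ∀ᶠ i in U, ∀ x, ‖F f i x - f (s i x)‖ ≤ e i := fun f =>
    (hmem f).mono fun i hi x => hs i x f hi
  have hnull : ∀ (G H : lp (fun _ : I => C(X, ℂ)) ∞) (C : ℝ),
      (∀ᶠ i in U, ∀ x, ‖G i x - H i x‖ ≤ C * e i) →
      Ultrapower.mk U C(X, ℂ) G = Ultrapower.mk U C(X, ℂ) H := by
    intro G H C h
    rw [Ultrapower.mk_eq_mk_iff]
    have h0 : Tendsto (fun i => C * e i) U (𝓝 0) := by simpa using he0.const_mul C
    refine squeeze_zero' (Eventually.of_forall fun i => norm_nonneg _) ?_ h0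
    filter_upwards [h] with i hi
    exact (ContinuousMap.norm_le_of_nonempty _).2 hi
  have hadd : ∀ f g, Ultrapower.mk U C(X, ℂ) (F (f + g)) =
      Ultrapower.mk U C(X, ℂ) (F f) + Ultrapower.mk U C(X, ℂ) (F g) := by
    intro f g
    rw [← map_add]
    refine hnull _ _ 3 ?_
    filter_upwards [hFs f, hFs g, hFs (f + g)] with i h1 h2 h3 x
    have h4 : F (f + g) i x - (F f + F g) i x =
        (F (f + g) i x - (f + g) (s i x)) - (F f i x - f (s i x)) - (F g i x - g (s i x)) := by
      have : (F f + F g) i x = F f i x + F g i x := rfl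
      rw [this, ContinuousMap.add_apply]
      ring
    rw [h4]
    refine (norm_sub_le _ _).trans ?_
    have := norm_sub_le (F (f + g) i x - (f + g) (s i x)) (F f i x - f (s i x))
    linarith [h1 x, h2 x, h3 x]
  have hmul : ∀ f g, Ultrapower.mk U C(X, ℂ) (F (f * g)) =
      Ultrapower.mk U C(X, ℂ) (F f) * Ultrapower.mk U C(X, ℂ) (F g) := by
    intro f g
    rw [← map_mul]
    refine hnull _ _ (1 + (‖g‖ + 1) + ‖f‖) ?_
    filter_upwards [hFs f, hFs g, hFs (f * g)] with i h1 h2 h3 x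
    have h4 : F (f * g) i x - (F f * F g) i x =
        (F (f * g) i x - (f * g) (s i x)) - (F f i x - f (s i x)) * F g i x
          - f (s i x) * (F g i x - g (s i x)) := by
      have : (F f * F g) i x = F f i x * F g i x := rfl
      rw [this, ContinuousMap.mul_apply]
      ring
    have h5 : ‖F g i x‖ ≤ ‖g‖ + 1 := ((F g i).norm_coe_le_norm x).trans (hbound g i)
    have h6 : ‖(F f i x - f (s i x)) * F g i x‖ ≤ e i * (‖g‖ + 1) :=
      (norm_mul_le _ _).trans (mul_le_mul (h1 x) h5 (norm_nonneg _) (he i).le)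
    have h7 : ‖f (s i x) * (F g i x - g (s i x))‖ ≤ ‖f‖ * e i :=
      (norm_mul_le _ _).trans
        (mul_le_mul (f.norm_coe_le_norm _) (h2 x) (norm_nonneg _) (norm_nonneg _))
    rw [h4]
    refine (norm_sub_le _ _).trans ?_
    have := norm_sub_le (F (f * g) i x - (f * g) (s i x)) ((F f i x - f (s i x)) * F g i x)
    linarith [h3 x]
  have hstar : ∀ f, Ultrapower.mk U C(X, ℂ) (F (star f)) =
      star (Ultrapower.mk U C(X, ℂ) (F f)) := by
    intro f
    rw [Ultrapower.star_mk]
    refine hnull _ _ 2 ?_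
    filter_upwards [hFs f, hFs (star f)] with i h1 h2 x
    have h4 : F (star f) i x - (star (F f)) i x =
        (F (star f) i x - (star f) (s i x)) - star (F f i x - f (s i x)) := by
      have : (star (F f)) i x = star (F f i x) := rfl
      rw [this, ContinuousMap.star_apply, star_sub]
      ring
    rw [h4]
    refine (norm_sub_le _ _).trans ?_
    rw [norm_star]
    linarith [h1 x, h2 x]
  have halg : ∀ c : ℂ, Ultrapower.mk U C(X, ℂ) (F (algebraMap ℂ _ c)) =
      algebraMap ℂ (Ultrapower U C(X, ℂ)) c := by
    intro c
    rw [← AlgHom.commutes (Ultrapower.mk U C(X, ℂ)) c]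
    refine hnull _ _ 1 ?_
    filter_upwards [hFs (algebraMap ℂ _ c)] with i h1 x
    rw [one_mul]
    exact h1 x
  let ψ : C(Y, ℂ) →⋆ₐ[ℂ] Ultrapower U C(X, ℂ) :=
    { toFun := fun f => Ultrapower.mk U C(X, ℂ) (F f)
      map_one' := by simpa using halg 1
      map_mul' := hmul
      map_zero' := by simpa using halg 0
      map_add' := hadd
      commutes' := halg
      map_star' := hstar }
  refine ⟨I, U, ψ, (injective_iff_map_eq_zero ψ).2 fun f hf => ?_⟩
  have hf0 : Tendsto (fun i => ‖F f i‖) U (𝓝 0) := by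
    rw [← Ultrapower.mem_nullIdeal]
    exact Ideal.Quotient.eq_zero_iff_mem.1 hf
  ext y
  have hy : Tendsto (fun i => ‖F f i‖ + e i) U (𝓝 0) := by simpa using hf0.add he0
  have hle : ‖f y‖ ≤ 0 := by
    refine ge_of_tendsto hy ?_
    filter_upwards [hmem f] with i hi
    obtain ⟨x, hx⟩ := hΦ2 i y
    have h1 := hx f hi
    have h2 := norm_sub_le (F f i x) (F f i x - f y)
    rw [sub_sub_cancel] at h2
    exact h2.trans (add_le_add ((F f i).norm_coe_le_norm x) h1)
  simpa using hle

/-! ### Embeddings of algebras of continuous functions and surjections of spaces -/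

theorem CStarEmbeds.trans {A : Type u} {B : Type v} {C : Type w} [CStarAlgebra A] [CStarAlgebra B]
    [CStarAlgebra C] (hAB : CStarEmbeds A B) (hBC : CStarEmbeds B C) : CStarEmbeds A C := by
  obtain ⟨φ, hφ⟩ := hAB
  obtain ⟨ψ, hψ⟩ := hBC
  exact ⟨ψ.comp φ, hψ.comp hφ⟩

theorem CStarEmbeds.of_starAlgEquiv {A : Type u} {B : Type v} [CStarAlgebra A] [CStarAlgebra B]
    (e : A ≃⋆ₐ[ℂ] B) : CStarEmbeds A B :=
  ⟨StarAlgHomClass.toStarAlgHom (R := ℂ) e, EquivLike.injective e⟩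

/-- By Gelfand duality, a `*`-homomorphism between algebras of continuous functions is composition
with a continuous map. -/
theorem exists_continuousMap_of_starAlgHom {Y : Type u} {Z : Type v} [TopologicalSpace Y]
    [CompactSpace Y] [T2Space Y] [TopologicalSpace Z] [CompactSpace Z]
    (φ : C(Y, ℂ) →⋆ₐ[ℂ] C(Z, ℂ)) :
    ∃ h : C(Z, Y), ∀ f z, φ f z = f (h z) := by
  let ev : Z → WeakDual.characterSpace ℂ C(Y, ℂ) := fun z =>
    WeakDual.CharacterSpace.compContinuousMap φ (WeakDual.CharacterSpace.continuousMapEval Z ℂ z)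
  have hev : Continuous ev := (ContinuousMap.continuous _).comp (ContinuousMap.continuous _)
  let η := WeakDual.CharacterSpace.homeoEval Y ℂ
  refine ⟨⟨fun z => η.symm (ev z), η.symm.continuous.comp hev⟩, fun f z => ?_⟩
  have h : η (η.symm (ev z)) f = ev z f := by rw [Homeomorph.apply_symm_apply]
  exact h.symm

/-- `C(Y)` embeds in `C(Z)` if and only if `Z` maps continuously onto `Y`. -/
theorem cstarEmbeds_continuousMap_iff {Y : Type u} {Z : Type v} [TopologicalSpace Y]
    [CompactSpace Y] [T2Space Y] [TopologicalSpace Z] [CompactSpace Z] :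
    CStarEmbeds C(Y, ℂ) C(Z, ℂ) ↔ ∃ f : Z → Y, Continuous f ∧ Function.Surjective f := by
  constructor
  · rintro ⟨φ, hφ⟩
    obtain ⟨h, hh⟩ := exists_continuousMap_of_starAlgHom φ
    refine ⟨h, h.continuous, fun y => ?_⟩
    by_contra hy
    obtain ⟨g, hg0, hg1, -⟩ := exists_continuous_zero_one_of_isClosed
      (isCompact_range h.continuous).isClosed (isClosed_singleton : IsClosed {y})
      (Set.disjoint_singleton_right.2 hy)
    -- A function separating `y` from the range of `h` is killed by `φ`.
    let f : C(Y, ℂ) := ⟨fun y => (g y : ℂ), by fun_prop⟩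
    have hf : f = 0 := hφ (by
      ext z
      rw [hh, map_zero]
      simpa [f] using hg0 (Set.mem_range_self z))
    have h1 : f y = 1 := by simpa [f] using hg1 rfl
    rw [hf] at h1
    simp at h1
  · rintro ⟨f, hf, hs⟩
    refine ⟨ContinuousMap.compStarAlgHom' ℂ ℂ ⟨f, hf⟩, fun a b hab => ?_⟩
    ext y
    obtain ⟨z, rfl⟩ := hs y
    exact congr($hab z)

/-! ### Bounded functions on the Stone–Čech compactification -/

/-- The extension of a bounded continuous function to the Stone–Čech compactification. -/
def stoneCechExtendBounded {Z : Type u} [TopologicalSpace Z] (g : BoundedContinuousFunction Z ℂ) :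
    C(StoneCech Z, ℂ) where
  toFun p := (stoneCechExtend (β := Metric.closedBall (0 : ℂ) ‖g‖)
    (g := fun z => ⟨g z, by simpa using g.norm_coe_le_norm z⟩) (by fun_prop) p : ℂ)
  continuous_toFun := continuous_subtype_val.comp (continuous_stoneCechExtend _)

@[simp]
theorem stoneCechExtendBounded_unit {Z : Type u} [TopologicalSpace Z]
    (g : BoundedContinuousFunction Z ℂ) (z : Z) :
    stoneCechExtendBounded g (stoneCechUnit z) = g z := by
  simp [stoneCechExtendBounded, stoneCechExtend_stoneCechUnit]

theorem StoneCech.continuousMap_ext {Z : Type u} [TopologicalSpace Z] {g h : C(StoneCech Z, ℂ)}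
    (H : ∀ z, g (stoneCechUnit z) = h (stoneCechUnit z)) : g = h :=
  DFunLike.coe_injective
    (g.continuous.ext_on denseRange_stoneCechUnit h.continuous (by rintro _ ⟨z, rfl⟩; exact H z))

/-! ### The algebra of continuous functions on an ultracopower -/

section Ultracopower

variable {I : Type w} (U : Ultrafilter I) (X : Type u) [TopologicalSpace X]

@[simp]
theorem coproductMap_unit {J K : Set I} (h : J ⊆ K) (z : Σ _ : J, X) :
    coproductMap X h (stoneCechUnit z) = stoneCechUnit (sumInclusion X h z) :=
  stoneCechExtend_stoneCechUnit _ z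

theorem continuous_coproductMap {J K : Set I} (h : J ⊆ K) : Continuous (coproductMap X h) :=
  continuous_stoneCechExtend _

instance : T2Space (Ultracopower U X) := by
  unfold Ultracopower
  infer_instance

instance : CompactSpace (Ultracopower U X) := by
  have h : IsClosed {p : (J : {J : Set I // J ∈ U}) → StoneCech (Σ _ : J.1, X) |
      ∀ (J K : {J : Set I // J ∈ U}) (h : J.1 ⊆ K.1), coproductMap X h (p J) = p K} := by
    simp only [Set.ofPred_forall]
    exact isClosed_iInter fun J => isClosed_iInter fun K => isClosed_iInter fun h =>
      isClosed_eq ((continuous_coproductMap X h).comp (continuous_apply J)) (continuous_apply K)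
  exact isCompact_iff_compactSpace.1 h.isCompact

/-- The projection of the ultracopower onto the factor `β(⨁_{i ∈ I} X)` of the inverse system. -/
def Ultracopower.proj : C(Ultracopower U X, StoneCech (Σ _ : (Set.univ : Set I), X)) where
  toFun p := p.1 ⟨Set.univ, univ_mem⟩
  continuous_toFun := (continuous_apply _).comp continuous_subtype_val

theorem Ultracopower.coproductMap_eq_proj (p : Ultracopower U X) (J : {J : Set I // J ∈ U}) :
    coproductMap X (Set.subset_univ J.1) (p.1 J) = proj U X p :=
  p.2 J ⟨Set.univ, univ_mem⟩ (Set.subset_univ J.1)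

/-- For nonempty `J` the sum over `J` is a retract of the sum over `K`. -/
theorem injective_coproductMap [Nonempty X] {J K : Set I} (hJ : J.Nonempty) (h : J ⊆ K) :
    Function.Injective (coproductMap X h) := by
  classical
  obtain ⟨j₀, hj₀⟩ := hJ
  obtain ⟨x₀⟩ := ‹Nonempty X›
  let r : (Σ _ : K, X) → (Σ _ : J, X) := fun p =>
    ⟨if hp : (p.1 : I) ∈ J then ⟨p.1, hp⟩ else ⟨j₀, hj₀⟩, p.2⟩
  have hr : Continuous r := continuous_sigma fun i =>
    continuous_sigmaMk (σ := fun _ : J => X)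
      (i := if hp : (i : I) ∈ J then ⟨i, hp⟩ else ⟨j₀, hj₀⟩)
  have hid : stoneCechExtend (continuous_stoneCechUnit.comp hr) ∘ coproductMap X h = id := by
    refine stoneCech_hom_ext ((continuous_stoneCechExtend _).comp (continuous_coproductMap X h))
      continuous_id (funext fun z => ?_)
    simp only [Function.comp_apply, coproductMap_unit, stoneCechExtend_stoneCechUnit, id]
    congr 1
    simp [r, sumInclusion]
  exact Function.LeftInverse.injective (congrFun hid)

theorem Ultracopower.injective_proj [Nonempty X] : Function.Injective (proj U X) := by
  intro p q hpq
  refine Subtype.ext (funext fun J => ?_)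
  refine injective_coproductMap X (U.nonempty_of_mem J.2) (Set.subset_univ J.1) ?_
  rw [coproductMap_eq_proj, coproductMap_eq_proj, hpq]

/-- A family of points of `X` determines a point of the ultracopower: the limit along `U` of the
corresponding points of the topological sum. -/
theorem Ultracopower.exists_tendsto_proj (x : I → X) :
    ∃ p : Ultracopower U X,
      Tendsto (fun i => stoneCechUnit (⟨⟨i, trivial⟩, x i⟩ : Σ _ : (Set.univ : Set I), X)) U
        (𝓝 (proj U X p)) := by
  classical
  have hlim : ∀ J : {J : Set I // J ∈ U}, ∃ q : StoneCech (Σ _ : J.1, X), ∀ s : I → J.1,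
      (∀ i ∈ J.1, (s i : I) = i) →
      Tendsto (fun i => stoneCechUnit (⟨s i, x i⟩ : Σ _ : J.1, X)) U (𝓝 q) := by
    intro J
    obtain ⟨j₀, hj₀⟩ := U.nonempty_of_mem J.2
    let s₀ : I → J.1 := fun i => if h : i ∈ J.1 then ⟨i, h⟩ else ⟨j₀, hj₀⟩
    obtain ⟨q, -, hq⟩ := (isCompact_univ (X := StoneCech (Σ _ : J.1, X))).ultrafilter_le_nhds
      (U.map fun i => stoneCechUnit (⟨s₀ i, x i⟩ : Σ _ : J.1, X)) (by simp)
    refine ⟨q, fun s hs => ?_⟩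
    have hq' : Tendsto (fun i => stoneCechUnit (⟨s₀ i, x i⟩ : Σ _ : J.1, X)) U (𝓝 q) := hq
    refine hq'.congr' ?_
    filter_upwards [J.2] with i hi
    have : s₀ i = s i := Subtype.ext (by simp [s₀, hi, hs i hi])
    rw [this]
  choose q hq using hlim
  refine ⟨⟨q, fun J K h => ?_⟩, hq ⟨Set.univ, univ_mem⟩ (fun i => ⟨i, trivial⟩) fun i _ => rfl⟩
  obtain ⟨j₀, hj₀⟩ := U.nonempty_of_mem J.2
  let s₀ : I → J.1 := fun i => if h : i ∈ J.1 then ⟨i, h⟩ else ⟨j₀, hj₀⟩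
  have hs₀ : ∀ i ∈ J.1, (s₀ i : I) = i := fun i hi => by simp [s₀, hi]
  have h1 := ((continuous_coproductMap X h).tendsto (q J)).comp (hq J s₀ hs₀)
  let s₁ : I → K.1 := fun i => if hi : i ∈ K.1 then ⟨i, hi⟩ else ⟨j₀, h hj₀⟩
  have h2 := hq K s₁ fun i hi => by simp [s₁, hi]
  refine tendsto_nhds_unique (h1.congr' ?_) h2
  filter_upwards [J.2] with i hi
  have hi' : i ∈ K.1 := h hi
  have : Set.inclusion h (s₀ i) = s₁ i := Subtype.ext (by simp [s₀, s₁, hi, hi'])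
  simp [sumInclusion, this]

variable [CompactSpace X]

/-- A bounded family of functions on `X`, as a bounded function on the topological sum of copies
of `X`. -/
def sumFunction (F : lp (fun _ : I => C(X, ℂ)) ∞) :
    BoundedContinuousFunction (Σ _ : (Set.univ : Set I), X) ℂ :=
  BoundedContinuousFunction.ofNormedAddCommGroup (fun p => F p.1 p.2)
    (continuous_sigma fun i => (F i).continuous) ‖F‖ fun p =>
      ((F p.1).norm_coe_le_norm p.2).trans (lp.norm_apply_le_norm (by simp) F p.1)

@[simp]
theorem sumFunction_apply (F : lp (fun _ : I => C(X, ℂ)) ∞) (p : Σ _ : (Set.univ : Set I), X) :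
    sumFunction X F p = F p.1 p.2 := rfl

/-- The `*`-homomorphism that extends a bounded family of functions to `β(⨁_{i ∈ I} X)` and then
restricts it to the ultracopower. -/
def Ultracopower.ofFamily [Nonempty X] :
    lp (fun _ : I => C(X, ℂ)) ∞ →⋆ₐ[ℂ] C(Ultracopower U X, ℂ) :=
  (ContinuousMap.compStarAlgHom' ℂ ℂ (proj U X)).comp
    { toFun := fun F => stoneCechExtendBounded (sumFunction X F)
      map_one' := StoneCech.continuousMap_ext fun z => by simp
      map_mul' := fun F G => StoneCech.continuousMap_ext fun z => by simp
      map_zero' := StoneCech.continuousMap_ext fun z => by simp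
      map_add' := fun F G => StoneCech.continuousMap_ext fun z => by simp
      commutes' := fun c => StoneCech.continuousMap_ext fun z => by
        rw [stoneCechExtendBounded_unit]; rfl
      map_star' := fun F => StoneCech.continuousMap_ext fun z => by simp }

theorem Ultracopower.ofFamily_apply [Nonempty X] (F : lp (fun _ : I => C(X, ℂ)) ∞)
    (p : Ultracopower U X) :
    ofFamily U X F p = stoneCechExtendBounded (sumFunction X F) (proj U X p) := rfl

theorem Ultracopower.surjective_ofFamily [Nonempty X] : Function.Surjective (ofFamily U X) := by
  intro g
  have he : IsClosedEmbedding (proj U X) :=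
    (proj U X).continuous.isClosedEmbedding (injective_proj U X)
  obtain ⟨G, hG⟩ := g.exists_extension' he
  have hb : ∀ i, ‖(⟨fun x => G (stoneCechUnit ⟨⟨i, trivial⟩, x⟩),
      G.continuous.comp (continuous_stoneCechUnit.comp continuous_sigmaMk)⟩ : C(X, ℂ))‖ ≤ ‖G‖ :=
    fun i => (ContinuousMap.norm_le_of_nonempty _).2 fun x => G.norm_coe_le_norm _
  let F : lp (fun _ : I => C(X, ℂ)) ∞ := ⟨_, memℓp_infty ⟨‖G‖, by rintro _ ⟨i, rfl⟩; exact hb i⟩⟩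
  have hF : stoneCechExtendBounded (sumFunction X F) = G := StoneCech.continuousMap_ext fun z => by
    rw [stoneCechExtendBounded_unit]; rfl
  refine ⟨F, ContinuousMap.ext fun p => ?_⟩
  rw [ofFamily_apply, hF]
  exact congrFun hG p

theorem Ultracopower.ofFamily_eq_zero_iff [Nonempty X] (F : lp (fun _ : I => C(X, ℂ)) ∞) :
    ofFamily U X F = 0 ↔ F ∈ nullIdeal U C(X, ℂ) := by
  rw [Ultrapower.mem_nullIdeal]
  constructor
  · -- Points where the `F i` attain their norms converge to a point of the ultracopower, and the
    -- norm of the extension of `F` there is the limit of the norms.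
    intro h
    have hx : ∀ i, ∃ x, ‖F i x‖ = ‖F i‖ := fun i => by
      obtain ⟨x, -, hx⟩ := isCompact_univ.exists_isMaxOn Set.univ_nonempty
        (F i).continuous.norm.continuousOn
      exact ⟨x, le_antisymm ((F i).norm_coe_le_norm x)
        ((ContinuousMap.norm_le_of_nonempty _).2 fun y => hx (Set.mem_univ y))⟩
    choose x hx using hx
    obtain ⟨p, hp⟩ := exists_tendsto_proj U X x
    have h1 := (((stoneCechExtendBounded (sumFunction X F)).continuous.norm).tendsto _).comp hp
    rw [← ofFamily_apply, h] at h1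
    simpa [Function.comp_def, hx] using h1
  · intro h
    ext p
    refine norm_le_zero_iff.1 (le_of_forall_pos_le_add fun ε hε => ?_)
    let J : {J : Set I // J ∈ U} := ⟨{i | ‖F i‖ ≤ ε}, h.eventually_le_const hε⟩
    rw [ofFamily_apply, ← coproductMap_eq_proj U X p J, zero_add]
    have hc : IsClosed {q : StoneCech (Σ _ : J.1, X) |
        ‖stoneCechExtendBounded (sumFunction X F) (coproductMap X (Set.subset_univ J.1) q)‖ ≤ ε} :=
      isClosed_le (((ContinuousMap.continuous _).comp (continuous_coproductMap X _)).norm)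
        continuous_const
    refine denseRange_stoneCechUnit.induction_on (p.1 J) hc fun z => ?_
    rw [coproductMap_unit, stoneCechExtendBounded_unit, sumFunction_apply]
    exact ((F z.1).norm_coe_le_norm z.2).trans z.1.2

/-- The ultrapower of `C(X)` is the algebra of continuous functions on the ultracopower of `X`. -/
def Ultracopower.starAlgEquiv [Nonempty X] :
    Ultrapower U C(X, ℂ) ≃⋆ₐ[ℂ] C(Ultracopower U X, ℂ) := by
  let θ : Ultrapower U C(X, ℂ) →ₐ[ℂ] C(Ultracopower U X, ℂ) :=
    Ideal.Quotient.liftₐ (nullIdeal U C(X, ℂ)) (ofFamily U X).toAlgHom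
      fun F hF => (ofFamily_eq_zero_iff U X F).2 hF
  have hθ : ∀ F, θ (Ultrapower.mk U C(X, ℂ) F) = ofFamily U X F := fun F => rfl
  refine StarAlgEquiv.ofBijective (show Ultrapower U C(X, ℂ) →⋆ₐ[ℂ] C(Ultracopower U X, ℂ) from
    { θ with
      map_star' := fun a => ?_ }) ⟨(injective_iff_map_eq_zero θ).2 fun a ha => ?_, fun g => ?_⟩
  · obtain ⟨F, rfl⟩ := Ultrapower.mk_surjective U C(X, ℂ) a
    exact map_star (ofFamily U X) F
  · obtain ⟨F, rfl⟩ := Ultrapower.mk_surjective U C(X, ℂ) a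
    exact Ideal.Quotient.eq_zero_iff_mem.2 ((ofFamily_eq_zero_iff U X F).1 ha)
  · obtain ⟨F, rfl⟩ := surjective_ofFamily U X g
    exact ⟨Ultrapower.mk U C(X, ℂ) F, hθ F⟩

end Ultracopower

/-- `C(Y)` embeds in an ultrapower of `C(X)` if and only if the ultracopower of `X` maps
continuously onto `Y`. -/
theorem cstarEmbeds_ultrapower_iff (X : Type u) (Y : Type v) [TopologicalSpace X] [CompactSpace X]
    [Nonempty X] [TopologicalSpace Y] [CompactSpace Y] [T2Space Y]
    {I : Type w} (U : Ultrafilter I) :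
    CStarEmbeds C(Y, ℂ) (Ultrapower U C(X, ℂ)) ↔
      ∃ f : Ultracopower U X → Y, Continuous f ∧ Function.Surjective f := by
  rw [← cstarEmbeds_continuousMap_iff]
  let e := Ultracopower.starAlgEquiv U X
  exact ⟨fun h => h.trans (.of_starAlgEquiv e), fun h => h.trans (.of_starAlgEquiv e.symm)⟩

/-! ### Universal sentences and ultrapowers -/

theorem CStarTerm.eval_map {n : ℕ} {A : Type u} {B : Type v} [CStarAlgebra A] [CStarAlgebra B]
    (φ : A →⋆ₐ[ℂ] B) (a : Fin n → A) (t : CStarTerm n) :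
    t.eval (fun k => φ (a k)) = φ (t.eval a) := by
  induction t with
  | var k => rfl
  | zero => exact (map_zero φ).symm
  | one => exact (map_one φ).symm
  | add s t hs ht => simp only [CStarTerm.eval, hs, ht, map_add]
  | mul s t hs ht => simp only [CStarTerm.eval, hs, ht, map_mul]
  | smul c t ht => simp only [CStarTerm.eval, ht, map_smul]
  | star t ht => simp only [CStarTerm.eval, ht, map_star]

/-- Quantifier-free formulas are preserved by embeddings, because these are isometric. -/
theorem QFFormula.eval_map {n : ℕ} {A : Type u} {B : Type v} [CStarAlgebra A] [CStarAlgebra B]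
    (ψ : A →⋆ₐ[ℂ] B) (hψ : Function.Injective ψ) (a : Fin n → A) (φ : QFFormula n) :
    φ.eval (fun k => ψ (a k)) = φ.eval a := by
  induction φ with
  | norm t =>
    simp only [QFFormula.eval, CStarTerm.eval_map]
    exact NonUnitalStarAlgHom.norm_map ψ hψ _
  | conn c φ ih => simp only [QFFormula.eval, ih]

section Los

variable {I : Type w} (U : Ultrafilter I) {A : Type u} [CommCStarAlgebra A] [Nontrivial A]

theorem CStarTerm.exists_eval_mk {n : ℕ} (F : Fin n → lp (fun _ : I => A) ∞) (t : CStarTerm n) :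
    ∃ G : lp (fun _ : I => A) ∞, (∀ i, G i = t.eval fun k => F k i) ∧
      Ultrapower.mk U A G = t.eval fun k => Ultrapower.mk U A (F k) := by
  induction t with
  | var k => exact ⟨F k, fun i => rfl, rfl⟩
  | zero => exact ⟨0, fun i => rfl, map_zero _⟩
  | one => exact ⟨1, fun i => rfl, map_one _⟩
  | add s t hs ht =>
    obtain ⟨G, hG, hG'⟩ := hs
    obtain ⟨H, hH, hH'⟩ := ht
    refine ⟨G + H, fun i => ?_, ?_⟩
    · rw [CStarTerm.eval, ← hG, ← hH]; rfl
    · rw [CStarTerm.eval, ← hG', ← hH', map_add]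
  | mul s t hs ht =>
    obtain ⟨G, hG, hG'⟩ := hs
    obtain ⟨H, hH, hH'⟩ := ht
    refine ⟨G * H, fun i => ?_, ?_⟩
    · rw [CStarTerm.eval, ← hG, ← hH]; rfl
    · rw [CStarTerm.eval, ← hG', ← hH', map_mul]
  | smul c t ht =>
    obtain ⟨G, hG, hG'⟩ := ht
    refine ⟨c • G, fun i => ?_, ?_⟩
    · rw [CStarTerm.eval, ← hG]; rfl
    · rw [CStarTerm.eval, ← hG', map_smul]
  | star t ht =>
    obtain ⟨G, hG, hG'⟩ := ht
    refine ⟨Star.star G, fun i => ?_, ?_⟩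
    · rw [CStarTerm.eval, ← hG]; rfl
    · rw [CStarTerm.eval, ← hG', Ultrapower.star_mk]

/-- The theorem of Łoś for quantifier-free formulas. -/
theorem QFFormula.tendsto_eval {n : ℕ} (F : Fin n → lp (fun _ : I => A) ∞) (φ : QFFormula n) :
    Tendsto (fun i => φ.eval fun k => F k i) U
      (𝓝 (φ.eval fun k => Ultrapower.mk U A (F k))) := by
  induction φ with
  | norm t =>
    obtain ⟨G, hG, hG'⟩ := t.exists_eval_mk U F
    obtain ⟨L, hL⟩ := Ultrapower.exists_tendsto_norm U A G
    simp only [QFFormula.eval, ← hG, ← hG', Ultrapower.norm_mk_eq U A G hL]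
    exact hL
  | conn c φ ih =>
    simp only [QFFormula.eval]
    exact (c.continuous.tendsto _).comp (tendsto_pi_nhds.2 ih)

/-- An element of norm at most `r` of an ultrapower is represented by a family of elements of norm
at most `r`. -/
theorem Ultrapower.exists_mk_eq_norm_le {r : ℝ} (hr : 0 ≤ r) (x : Ultrapower U A) (hx : ‖x‖ ≤ r) :
    ∃ F : lp (fun _ : I => A) ∞, mk U A F = x ∧ ∀ i, ‖F i‖ ≤ r := by
  obtain ⟨G, rfl⟩ := mk_surjective U A x
  obtain ⟨L, hL⟩ := exists_tendsto_norm U A G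
  rw [norm_mk_eq U A G hL] at hx
  -- Radial retraction onto the ball of radius `r`; when `r = 0` the quotient may be `0 / 0 = 0`,
  -- which is harmless since `G i = 0` then.
  let c : I → ℝ := fun i => r / max r ‖G i‖
  have hc : ∀ i, c i * ‖G i‖ ≤ r := fun i => by
    rw [div_mul_eq_mul_div]
    exact div_le_of_le_mul₀ (hr.trans (le_max_left _ _)) hr
      (mul_le_mul_of_nonneg_left (le_max_right _ _) hr)
  have hc0 : ∀ i, 0 ≤ c i := fun i => div_nonneg hr (hr.trans (le_max_left _ _))
  have hn : ∀ i, ‖(c i : ℂ) • G i‖ ≤ r := fun i => by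
    rw [norm_smul, Complex.norm_real, Real.norm_of_nonneg (hc0 i)]
    exact hc i
  refine ⟨⟨fun i => (c i : ℂ) • G i, memℓp_infty ⟨r, by rintro _ ⟨i, rfl⟩; exact hn i⟩⟩, ?_, hn⟩
  rw [mk_eq_mk_iff]
  have hlim : Tendsto (fun i => max (‖G i‖ - r) 0) U (𝓝 0) := by
    have h := (hL.sub_const r).max (tendsto_const_nhds (x := (0 : ℝ)))
    rwa [max_eq_right (sub_nonpos.2 hx)] at h
  refine squeeze_zero (fun i => norm_nonneg _) (fun i => ?_) hlim
  have h1 : (c i : ℂ) • G i - G i = ((c i - 1 : ℝ) : ℂ) • G i := by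
    push_cast
    rw [sub_smul, one_smul]
  show ‖(c i : ℂ) • G i - G i‖ ≤ _
  rw [h1, norm_smul, Complex.norm_real]
  have hG := norm_nonneg (G i)
  rcases hG.eq_or_lt with h0 | h0
  · rw [← h0, mul_zero]
    exact le_max_right _ _
  · have hm : 0 < max r ‖G i‖ := h0.trans_le (le_max_right _ _)
    have hc1 : c i ≤ 1 := (div_le_one hm).2 (le_max_left _ _)
    rw [Real.norm_of_nonpos (sub_nonpos.2 hc1)]
    rcases le_total r ‖G i‖ with h | h
    · have : c i * ‖G i‖ = r := by
        simp only [c, max_eq_right h]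
        exact div_mul_cancel₀ r h0.ne'
      refine le_trans (le_of_eq ?_) (le_max_left _ _)
      linarith
    · have : c i = 1 := by
        simp only [c, max_eq_left h]
        exact div_self (h0.trans_le h).ne'
      rw [this]
      simp

/-- The value of a universal sentence can only decrease when passing to a subalgebra of an
ultrapower. -/
theorem UniversalSentence.value_le_of_cstarEmbeds_ultrapower {B : Type v} [CStarAlgebra B]
    (h : CStarEmbeds B (Ultrapower U A)) (σ : UniversalSentence) : σ.value B ≤ σ.value A := by
  obtain ⟨ψ, hψ⟩ := h
  refine (σ.isLUB_value B).2 ?_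
  rintro _ ⟨b, hb, rfl⟩
  choose F hF hFr using fun k => Ultrapower.exists_mk_eq_norm_le U (Nat.cast_nonneg (σ.radius k))
    (ψ (b k)) ((NonUnitalStarAlgHom.norm_map ψ hψ _).trans_le (hb k))
  have hlim := σ.formula.tendsto_eval U F
  simp only [hF, QFFormula.eval_map ψ hψ] at hlim
  exact le_of_tendsto' hlim fun i => (σ.isLUB_value A).1 ⟨_, fun k => hFr k i, rfl⟩

end Los

theorem UniversalSentence.value_le_of_cstarEmbeds {A : Type u} {B : Type v} [CStarAlgebra A]
    [CStarAlgebra B] (h : CStarEmbeds A B) (σ : UniversalSentence) : σ.value A ≤ σ.value B := by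
  obtain ⟨ψ, hψ⟩ := h
  refine (σ.isLUB_value A).2 ?_
  rintro _ ⟨a, ha, rfl⟩
  exact (σ.isLUB_value B).1 ⟨fun k => ψ (a k),
    fun k => (NonUnitalStarAlgHom.norm_map ψ hψ _).trans_le (ha k), QFFormula.eval_map ψ hψ _ _⟩

/-! ### Character spaces of projectionless algebras -/

open WeakDual

/-- The Gelfand spectrum of a projectionless algebra is connected, since the characteristic function
of a clopen set is a projection. -/
theorem IsProjectionless.connectedSpace {A : Type u} [CommCStarAlgebra A] (h : IsProjectionless A) :
    ConnectedSpace (characterSpace ℂ A) := by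
  obtain ⟨hA, hp⟩ := h
  have : PreconnectedSpace (characterSpace ℂ A) := by
    refine preconnectedSpace_iff_clopen.2 fun s hs => ?_
    let χ : C(characterSpace ℂ A, ℂ) :=
      ⟨s.indicator 1, (continuous_const (y := (1 : ℂ))).indicator fun x hx => by
        simp [hs.frontier_eq] at hx⟩
    have hχ : ∀ x, χ x = s.indicator 1 x := fun _ => rfl
    have hχp : IsStarProjection χ := by
      refine ⟨ContinuousMap.ext fun x => ?_, ContinuousMap.ext fun x => ?_⟩
      · by_cases hx : x ∈ s <;> simp [hχ, hx]
      · by_cases hx : x ∈ s <;> simp [hχ, hx]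
    let e := gelfandStarTransform A
    have hq : IsStarProjection (e.symm χ) := hχp.map e.symm
    rcases hp _ hq with h0 | h1
    · left
      have h0' : χ = 0 := by simpa using h0
      refine Set.eq_empty_of_forall_notMem fun x hx => ?_
      have := congr($h0' x)
      simp [hχ, hx] at this
    · right
      have h1' : χ = 1 := by rw [← e.apply_symm_apply χ, h1, map_one]
      refine Set.eq_univ_of_forall fun x => ?_
      by_contra hx
      have := congr($h1' x)
      simp [hχ, hx] at this
  exact { toNonempty := inferInstance }

/-- The Gelfand spectrum of a nonzero algebra other than `ℂ` has at least two points. -/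
theorem nontrivial_characterSpace {A : Type u} [CommCStarAlgebra A] [Nontrivial A]
    (h : ¬ IsDegenerate A) : Nontrivial (characterSpace ℂ A) := by
  by_contra hn
  rw [not_nontrivial_iff_subsingleton] at hn
  obtain ⟨x⟩ : Nonempty (characterSpace ℂ A) := inferInstance
  let e : C(characterSpace ℂ A, ℂ) ≃⋆ₐ[ℂ] ℂ := StarAlgEquiv.ofBijective
    (ContinuousMap.evalStarAlgHom ℂ ℂ x)
    ⟨fun f g hfg => ContinuousMap.ext fun y => by rw [Subsingleton.elim y x]; exact hfg,
      fun c => ⟨ContinuousMap.const _ c, rfl⟩⟩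
  exact h ⟨(gelfandStarTransform A).trans e⟩

theorem UniversalSentence.value_le_of_isProjectionless {A : Type u} {B : Type v}
    [CommCStarAlgebra A] [CommCStarAlgebra B] (hA : IsProjectionless A) (hB : IsProjectionless B)
    (hB' : ¬ IsDegenerate B) (σ : UniversalSentence) : σ.value A ≤ σ.value B := by
  have := hB.1
  have := hA.connectedSpace
  have := hB.connectedSpace
  have := nontrivial_characterSpace hB'
  obtain ⟨I, U, hU⟩ := exists_cstarEmbeds_ultrapower (characterSpace ℂ B) (characterSpace ℂ A)
  calc σ.value A ≤ σ.value C(characterSpace ℂ A, ℂ) :=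
        σ.value_le_of_cstarEmbeds (.of_starAlgEquiv (gelfandStarTransform A))
    _ ≤ σ.value C(characterSpace ℂ B, ℂ) := σ.value_le_of_cstarEmbeds_ultrapower U hU
    _ ≤ σ.value B :=
        σ.value_le_of_cstarEmbeds (.of_starAlgEquiv (gelfandStarTransform B).symm)

end

theorem mainTheorem2 :
    (∀ (X : Type u) (Y : Type v)
      [TopologicalSpace X] [CompactSpace X] [T2Space X] [ConnectedSpace X] [Nontrivial X]
      [TopologicalSpace Y] [CompactSpace Y] [T2Space Y] [ConnectedSpace Y],
      (∃ (I : Type v) (U : Ultrafilter I),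
        CStarEmbeds C(Y, ℂ) (Ultrapower U C(X, ℂ)) ∧
        ∃ f : Ultracopower U X → Y, Continuous f ∧ Function.Surjective f) ∧
      (∀ (I : Type w) (U : Ultrafilter I),
        CStarEmbeds C(Y, ℂ) (Ultrapower U C(X, ℂ)) ↔
        ∃ f : Ultracopower U X → Y, Continuous f ∧ Function.Surjective f)) ∧
    (∀ (A : Type u) (B : Type v) [CommCStarAlgebra A] [CommCStarAlgebra B],
      IsProjectionless A → ¬ IsDegenerate A → IsProjectionless B → ¬ IsDegenerate B →
      universalTheory A = universalTheory B) := by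
  refine ⟨fun X Y => ⟨?_, fun I U => cstarEmbeds_ultrapower_iff X Y U⟩, ?_⟩
  · obtain ⟨I, U, hU⟩ := exists_cstarEmbeds_ultrapower X Y
    exact ⟨I, U, hU, (cstarEmbeds_ultrapower_iff X Y U).1 hU⟩
  · intro A B _ _ hA hA' hB hB'
    exact funext fun σ => le_antisymm (σ.value_le_of_isProjectionless hA hB hB')
      (σ.value_le_of_isProjectionless hB hA hA')
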